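/- Let $M\subset\mathbb{R}^3$ be an open book structure: a compact connected set that is the disjoint union of finitely many pages $M_k$ (connected smooth embedded open surfaces, relatively open in $M$) and finitely many bindings $E_m$ (closed smooth embedded curves), such that near every point of a binding $E_m$ the set $M$ is the union of finitely many (at least one) smooth surfaces with common boundary $E_m$, which meet only along $E_m$ and meet there transversely, i.e. with pairwise different inward conormals. For $\varepsilon>0$ let $M_\varepsilon=\bigcup_{x\in M}B(x,\varepsilon)$. Fix sleeve widths $a_m>0$ independent of $\varepsilon$, and let $$S_{k,m,\varepsilon}=\{x\in M_k:\ \mathrm{dist}_{M_k}(x,E_m)<a_m\varepsilon\},\qquad E_{m,\varepsilon}=\bigcup_{x\in E_m}B(x,\varepsilon)\ \cup\ \bigcup_k\bigcup_{x\in S_{k,m,\varepsilon}}I_{k,\varepsilon}(x),$$ where $\mathrm{dist}_{M_k}$ is the geodesic distance on the page $M_k$ and $I_{k,\varepsilon}(x)$ is the open segment of radius $\varepsilon$ centred at $x$ on the line normal to $M_k$ at $x$; $E_{m,\varepsilon}$ is called the fattened binding about $E_m$. Theorem. There is a constant $c>0$, depending only on $M$ and the widths $a_m$, such that for every $\varepsilon>0$,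 every binding $E_m$ and every (real- or complex-valued) $u\in H^1(M_\varepsilon)$, $$\|u\|^2_{L_2(E_{m,\varepsilon})}\le c\,\varepsilon\,\|u\|^2_{H^1(M_\varepsilon)},$$ where $\|u\|^2_{H^1(M_\varepsilon)}=\int_{M_\varepsilon}\left(|u|^2+|\nabla u|^2\right)dx$. -/

import Mathlib

open MeasureTheory Set
open scoped ENNReal ContDiff

/-- Euclidean three-space. -/
abbrev E3 : Type := EuclideanSpace ℝ (Fin 3)

/-! ### Smooth surfaces, curves and half-surfaces in three-space -/

/-- A smooth local change of coordinates of three-space (a `C^∞` diffeomorphism between two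
open sets). -/
def IsSmoothChart (Φ : OpenPartialHomeomorph E3 E3) : Prop :=
  ContDiffOn ℝ ∞ Φ Φ.source ∧ ContDiffOn ℝ ∞ Φ.symm Φ.target

/-- `P` is a smooth embedded surface without boundary: near each of its points a smooth chart
takes it to the plane where the last coordinate vanishes. -/
def IsSmoothSurface (P : Set E3) : Prop :=
  ∀ x ∈ P, ∃ Φ : OpenPartialHomeomorph E3 E3, IsSmoothChart Φ ∧ x ∈ Φ.source ∧
    ∀ y ∈ Φ.source, y ∈ P ↔ Φ y 2 = 0

/-- `E` is a smooth embedded curve without endpoints: near each of its points a smooth chart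
takes it to the line where the last two coordinates vanish. -/
def IsSmoothCurve (E : Set E3) : Prop :=
  ∀ x ∈ E, ∃ Φ : OpenPartialHomeomorph E3 E3, IsSmoothChart Φ ∧ x ∈ Φ.source ∧
    ∀ y ∈ Φ.source, y ∈ E ↔ Φ y 1 = 0 ∧ Φ y 2 = 0

/-- A closed smooth curve: compact, connected (in particular non-empty), without endpoints. -/
def IsClosedSmoothCurve (E : Set E3) : Prop :=
  IsCompact E ∧ IsConnected E ∧ IsSmoothCurve E

/-- In the set `U`, `H` is a smooth surface with boundary `E`: a smooth chart takes `H` to a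
half-plane and `E` to the edge of that half-plane. -/
def IsHalfSurfaceIn (U H E : Set E3) : Prop :=
  ∃ Φ : OpenPartialHomeomorph E3 E3, IsSmoothChart Φ ∧ U ⊆ Φ.source ∧
    ∀ y ∈ U, (y ∈ H ↔ 0 ≤ Φ y 1 ∧ Φ y 2 = 0) ∧ (y ∈ E ↔ Φ y 1 = 0 ∧ Φ y 2 = 0)

/-- `ν` is the inward conormal at `x` of the surface `H` with boundary `E`: the unit vector that
is tangent to `H`, points into `H`, and is normal to `E`. -/
def IsInwardConormal (H E : Set E3) (x ν : E3) : Prop :=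
  ν ∈ posTangentConeAt H x ∧ ‖ν‖ = 1 ∧ ∀ τ ∈ tangentConeAt ℝ E x, inner ℝ τ ν = 0

/-- Near the point `x` of the curve `E`, the set `M` is an open book with binding `E`: it is the
union of finitely many (at least one) smooth half-surfaces with common boundary `E`, which meet
only along `E`, and there transversely, that is, with pairwise different inward conormals. -/
def IsOpenBookNear (M E : Set E3) (x : E3) : Prop :=
  ∃ U : Set E3, IsOpen U ∧ x ∈ U ∧ ∃ n : ℕ, 0 < n ∧ ∃ H : Fin n → Set E3,
    M ∩ U = (⋃ i, H i) ∩ U ∧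
    (∀ i, IsHalfSurfaceIn U (H i) E) ∧
    ∀ i j, i ≠ j → H i ∩ H j ∩ U ⊆ E ∧
      ∀ ν, ¬ (IsInwardConormal (H i) E x ν ∧ IsInwardConormal (H j) E x ν)

/-! ### Open book structures and their fattened counterparts -/

/-- An open book structure: a compact connected smooth stratified surface in three-space whose
strata are finitely many pages (connected open smooth surfaces) and finitely many bindings
(closed smooth curves), at which the pages meet transversely. There are no point strata. -/
structure OpenBook where
  /-- the variety itself -/
  carrier : Set E3
  /-- the number of pages -/
  nM : ℕ
  /-- the number of bindings -/
  nE : ℕ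
  /-- the (open) pages -/
  page : Fin nM → Set E3
  /-- the bindings -/
  binding : Fin nE → Set E3
  isCompact_carrier : IsCompact carrier
  isConnected_carrier : IsConnected carrier
  carrier_eq : carrier = (⋃ k, page k) ∪ ⋃ m, binding m
  page_disjoint : ∀ k l, k ≠ l → Disjoint (page k) (page l)
  binding_disjoint : ∀ m n, m ≠ n → Disjoint (binding m) (binding n)
  page_binding_disjoint : ∀ k m, Disjoint (page k) (binding m)
  page_connected : ∀ k, IsConnected (page k)
  page_smooth : ∀ k, IsSmoothSurface (page k)
  /-- away from the bindings, the variety is locally a single page -/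
  page_open : ∀ k, ∃ U : Set E3, IsOpen U ∧ carrier ∩ U = page k
  binding_closedCurve : ∀ m, IsClosedSmoothCurve (binding m)
  /-- at the bindings, the variety is locally an open book -/
  binding_openBook : ∀ m, ∀ x ∈ binding m, IsOpenBookNear carrier (binding m) x

/-- The geodesic distance on the page `P` from the point `x` to the part `E` of its boundary: the
infimum of the lengths of the curves that start in `x`, run in `P` and end on `E` (infinite if
there are none). -/
noncomputable def pageDist (P E : Set E3) (x : E3) : ℝ≥0∞ :=
  ⨅ γ ∈ {γ : ℝ → E3 | ContinuousOn γ (Icc 0 1) ∧ γ 0 = x ∧ γ 1 ∈ E ∧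
    ∀ t ∈ Ico (0 : ℝ) 1, γ t ∈ P}, eVariationOn γ (Icc 0 1)

/-- The open interval of radius `ε` around `x` on the normal line to the surface `P` at `x`. -/
def normalFiber (P : Set E3) (ε : ℝ) (x : E3) : Set E3 :=
  {z | dist z x < ε ∧ ∀ v ∈ tangentConeAt ℝ P x, inner ℝ v (z - x) = 0}

namespace OpenBook

/-- The uniformly fattened domain: the union of the open balls of radius `ε` about the points of
the open book structure. -/
def fattened (M : OpenBook) (ε : ℝ) : Set E3 :=
  ⋃ x ∈ M.carrier, Metric.ball x ε

/-- The sleeve of width `a m * ε` on the page `k` at the binding `m`. -/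
def sleeve (M : OpenBook) (a : Fin M.nE → ℝ) (k : Fin M.nM) (m : Fin M.nE) (ε : ℝ) : Set E3 :=
  {x ∈ M.page k | pageDist (M.page k) (M.binding m) x < ENNReal.ofReal (a m * ε)}

/-- The fattened binding: the union of the `ε`-neighborhood of the binding and of the normal
fibers of radius `ε` over its sleeves. -/
def fattenedBinding (M : OpenBook) (a : Fin M.nE → ℝ) (m : Fin M.nE) (ε : ℝ) : Set E3 :=
  (⋃ x ∈ M.binding m, Metric.ball x ε) ∪
    ⋃ k, ⋃ x ∈ M.sleeve a k m ε, normalFiber (M.page k) ε x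

end OpenBook

/-! ### The Sobolev space `H^1` -/

section Sobolev

/-- The squared `L_2` norm on `Ω`, as an extended non-negative real. -/
noncomputable def l2NormSq {F : Type*} [NormedAddCommGroup F] (Ω : Set E3) (f : E3 → F) : ℝ≥0∞ :=
  ∫⁻ x in Ω, ‖f x‖ₑ ^ 2

/-- `g` is a square integrable weak gradient of `u` on the open set `Ω`. -/
def HasL2WeakGradient {𝕜 : Type*} [RCLike 𝕜] (Ω : Set E3) (u : E3 → 𝕜)
    (g : E3 → EuclideanSpace 𝕜 (Fin 3)) : Prop :=
  MemLp g 2 (volume.restrict Ω) ∧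
    ∀ φ : E3 → ℝ, ContDiff ℝ ∞ φ → HasCompactSupport φ → tsupport φ ⊆ Ω →
      ∀ i : Fin 3, ∫ x in Ω, (fderiv ℝ φ x (EuclideanSpace.single i 1)) • u x =
        - ∫ x in Ω, φ x • g x i

/-- `u` belongs to the Sobolev space `H^1(Ω)`. -/
def MemH1 {𝕜 : Type*} [RCLike 𝕜] (Ω : Set E3) (u : E3 → 𝕜) : Prop :=
  MemLp u 2 (volume.restrict Ω) ∧ ∃ g, HasL2WeakGradient Ω u g

open Classical in
/-- The weak gradient of `u` on `Ω` (unique almost everywhere on `Ω` for `u` in `H^1(Ω)`). -/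
noncomputable def weakGradient {𝕜 : Type*} [RCLike 𝕜] (Ω : Set E3) (u : E3 → 𝕜) :
    E3 → EuclideanSpace 𝕜 (Fin 3) :=
  if h : ∃ g, HasL2WeakGradient Ω u g then h.choose else 0

/-- The squared `H^1` norm of `u` on `Ω`. -/
noncomputable def h1NormSq {𝕜 : Type*} [RCLike 𝕜] (Ω : Set E3) (u : E3 → 𝕜) : ℝ≥0∞ :=
  l2NormSq Ω u + l2NormSq Ω (weakGradient Ω u)

end Sobolev

/-! Geodesic distance dominates Euclidean distance, so the fattened binding lies in the
`ε`-neighbourhood of the part of `M` within `a m * ε` of the binding (`fattenedBinding_subset`). It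
remains to bound a function there.

For `C¹` functions, straighten one half-surface to the half-plane `w 1 ≥ 0, w 2 = 0`. From a point
near the edge, the direction `w 1` runs along the half-surface for a fixed length `R`. The
one-dimensional trace estimate bounds the squared value at the start by an integral over this
segment. The starting points lie in a slab `|w 1| < c * ε`, so each point of space is swept for a
time at most `2 * c * ε`; Tonelli gives the factor `ε` (`lintegral_slab_le`,
`IsHalfSurfaceIn.exists_lintegral_le`).

The chart is only bi-Lipschitz: for the segments to stay in the `ε`-neighbourhood, the starting
points must lie in a thinner `δ * ε`-neighbourhood. Averaging over balls recovers the full thickness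
at the cost of `ε ^ 2` times the Dirichlet integral (`lintegral_thickening_le_shrink`). Compactness
of the binding makes the constants uniform.

Mollification and Fatou's lemma pass to `H¹`. For `ε` bounded below the claim is trivial, with a
large constant. -/

/-! ### Elementary inequalities and the one-dimensional trace estimate. -/

theorem ENNReal.add_sq_le_two_mul (a b : ℝ≥0∞) : (a + b) ^ 2 ≤ 2 * a ^ 2 + 2 * b ^ 2 := by
  have h := ENNReal.rpow_add_le_mul_rpow_add_rpow a b (p := 2) (by norm_num)
  have e : (2 : ℝ≥0∞) ^ ((2 : ℝ) - 1) = 2 := by norm_num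
  rw [e, mul_add] at h
  exact_mod_cast h

/-- Weighted Cauchy–Schwarz (Jensen) inequality for the lower Lebesgue integral. -/
theorem sq_lintegral_mul_le {α : Type*} [MeasurableSpace α] {μ : Measure α} {f g : α → ℝ≥0∞}
    (hf : AEMeasurable f μ) (hg : AEMeasurable g μ) :
    (∫⁻ x, f x * g x ∂μ) ^ 2 ≤ (∫⁻ x, f x ∂μ) * ∫⁻ x, f x * g x ^ 2 ∂μ := by
  have hsq : ∀ a : ℝ≥0∞, (a ^ (1 / 2 : ℝ)) * (a ^ (1 / 2 : ℝ)) = a := fun a => by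
    rw [← ENNReal.rpow_add_of_nonneg _ _ (by norm_num) (by norm_num)]; norm_num
  have hsq' : ∀ a : ℝ≥0∞, (a ^ (1 / 2 : ℝ)) ^ (2 : ℝ) = a := fun a => by
    rw [← ENNReal.rpow_mul]; norm_num
  have hpq : (2 : ℝ).HolderConjugate 2 := Real.HolderConjugate.two_two
  -- Hölder for the factorization `f * g = f^(1/2) * (f^(1/2) * g)`.
  have h := ENNReal.lintegral_mul_le_Lp_mul_Lq μ hpq (hf.pow_const (1 / 2 : ℝ))
    ((hf.pow_const (1 / 2 : ℝ)).mul hg)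
  have h1 : ∀ x, ((fun x => f x ^ (1 / 2 : ℝ)) * ((fun x => f x ^ (1 / 2 : ℝ)) * g)) x
      = f x * g x := fun x => by
    simp only [Pi.mul_apply]; rw [← mul_assoc, hsq]
  have h2 : ∀ x, (((fun x => f x ^ (1 / 2 : ℝ)) * g) x) ^ (2 : ℝ) = f x * g x ^ 2 := fun x => by
    simp only [Pi.mul_apply]
    rw [ENNReal.mul_rpow_of_nonneg _ _ (by norm_num), hsq']; norm_num
  simp only [h1, h2, hsq'] at h
  calc _ ≤ _ := pow_le_pow_left₀ (zero_le) h 2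
    _ = _ := by rw [mul_pow, sq, sq, hsq, hsq]

/-- One-dimensional trace estimate. -/
theorem enorm_sq_le_trace {F : Type*} [NormedAddCommGroup F] [NormedSpace ℝ F] [CompleteSpace F]
    {f f' : ℝ → F} {T s : ℝ} (hs : s ∈ Icc 0 T)
    (hf : ∀ t ∈ Icc 0 T, HasDerivAt f (f' t) t) (hf' : ContinuousOn f' (Icc 0 T)) :
    ‖f 0‖ₑ ^ 2 ≤ 2 * ‖f s‖ₑ ^ 2 + 2 * (ENNReal.ofReal T * ∫⁻ t in Icc 0 T, ‖f' t‖ₑ ^ 2) := by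
  have hsub : uIcc 0 s ⊆ Icc 0 T := by
    rw [uIcc_of_le hs.1]; exact Icc_subset_Icc_right hs.2
  have hFTC := intervalIntegral.integral_eq_sub_of_hasDerivAt (fun t ht => hf t (hsub ht))
    ((hf'.mono hsub).intervalIntegrable)
  have h1 : ‖f s - f 0‖ₑ ≤ ∫⁻ t in Icc 0 T, ‖f' t‖ₑ := by
    rw [← hFTC, intervalIntegral.integral_of_le hs.1]
    exact (enorm_integral_le_lintegral_enorm _).trans
      (lintegral_mono_set (Ioc_subset_Icc_self.trans (Icc_subset_Icc_right hs.2)))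
  have h2 : (∫⁻ t in Icc 0 T, ‖f' t‖ₑ) ^ 2 ≤ ENNReal.ofReal T * ∫⁻ t in Icc 0 T, ‖f' t‖ₑ ^ 2 := by
    have := sq_lintegral_mul_le (μ := volume.restrict (Icc 0 T)) (f := fun _ => 1)
      (g := fun t => ‖f' t‖ₑ) aemeasurable_const
      (hf'.aestronglyMeasurable measurableSet_Icc).enorm
    simpa using this
  have h3 : ‖f 0‖ₑ ≤ ‖f s‖ₑ + ‖f s - f 0‖ₑ := by
    have := enorm_sub_le (E := F) (a := f s) (b := f s - f 0)
    simpa using this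
  calc ‖f 0‖ₑ ^ 2 ≤ (‖f s‖ₑ + ‖f s - f 0‖ₑ) ^ 2 := pow_le_pow_left₀ zero_le h3 2
    _ ≤ _ := ENNReal.add_sq_le_two_mul _ _
    _ ≤ _ := by
      gcongr
      exact (pow_le_pow_left₀ zero_le h1 2).trans h2

/-! ### Comparing neighbourhoods of different thickness. -/

section Shrink

variable {F : Type*} [NormedAddCommGroup F] [NormedSpace ℝ F] [CompleteSpace F]

theorem enorm_sq_le_segment {v : E3 → F} (hv : ContDiff ℝ 1 v) (z h : E3) :
    ‖v z‖ₑ ^ 2 ≤ 2 * ‖v (z + h)‖ₑ ^ 2 +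
      2 * ∫⁻ t in Icc (0 : ℝ) 1, ‖h‖ₑ ^ 2 * ‖fderiv ℝ v (z + t • h)‖ₑ ^ 2 := by
  have hd : ∀ t ∈ Icc (0 : ℝ) 1, HasDerivAt (fun t : ℝ => v (z + t • h))
      (fderiv ℝ v (z + t • h) h) t := fun t _ => by
    have h1 : HasDerivAt (fun t : ℝ => z + t • h) h t := by
      simpa using ((hasDerivAt_id t).smul_const h).const_add z
    exact ((hv.differentiable one_ne_zero) _).hasFDerivAt.comp_hasDerivAt t h1
  have hc : Continuous fun t : ℝ => fderiv ℝ v (z + t • h) h :=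
    ((hv.continuous_fderiv one_ne_zero).comp (by fun_prop)).clm_apply continuous_const
  have := enorm_sq_le_trace (T := 1) (s := 1) (by simp) hd hc.continuousOn
  simp only [zero_smul, add_zero, one_smul, ENNReal.ofReal_one, one_mul] at this
  refine this.trans ?_
  gcongr with t
  rw [← mul_pow, mul_comm]
  exact pow_le_pow_left₀ zero_le (ContinuousLinearMap.le_opENorm _ _) 2

/-- Given `z` within `ε` of some `y ∈ A`, compare `v z` with `v (z + h)`, where `z + h` runs over
the ball of radius `δ * ε` about `y`. The segment stays in the convex ball of radius `ε` about `y`.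
Since `y` depends on `z`, the range of `h` is enlarged to a ball of radius `2 * ε` about `0`;
Tonelli and translation invariance then apply. -/
theorem shrink_aux {v : E3 → F} (hv : ContDiff ℝ 1 v) (A : Set E3) {ε δ : ℝ} (hε : 0 < ε)
    (hδ1 : δ ≤ 1) :
    volume (Metric.ball (0 : E3) (δ * ε)) * ∫⁻ z in Metric.thickening ε A, ‖v z‖ₑ ^ 2 ≤
      volume (Metric.ball (0 : E3) (2 * ε)) *
        (2 * (∫⁻ z in Metric.thickening (δ * ε) A, ‖v z‖ₑ ^ 2) + 2 * (ENNReal.ofReal (2 * ε) ^ 2 *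
          ∫⁻ z in Metric.thickening ε A, ‖fderiv ℝ v z‖ₑ ^ 2)) := by
  set Ω := Metric.thickening ε A with hΩ
  set D := Metric.thickening (δ * ε) A with hD
  have hΩm : MeasurableSet Ω := Metric.isOpen_thickening.measurableSet
  have hDm : MeasurableSet D := Metric.isOpen_thickening.measurableSet
  have hδε : δ * ε ≤ ε := by nlinarith
  set p : E3 → ℝ≥0∞ := D.indicator fun z => ‖v z‖ₑ ^ 2 with hp
  set q : E3 → ℝ≥0∞ := Ω.indicator fun z => ‖fderiv ℝ v z‖ₑ ^ 2 with hq
  have hpm : Measurable p :=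
    ((hv.continuous.enorm.measurable).pow_const 2).indicator hDm
  have hqm : Measurable q :=
    (((hv.continuous_fderiv one_ne_zero).enorm.measurable).pow_const 2).indicator hΩm
  set P : E3 → E3 → ℝ≥0∞ := fun z h => 2 * p (z + h) +
    2 * ∫⁻ t in Icc (0 : ℝ) 1, ENNReal.ofReal (2 * ε) ^ 2 * q (z + t • h) with hP
  have hPm : Measurable (Function.uncurry P) := by
    refine Measurable.add ?_ ?_
    · exact (hpm.comp (measurable_fst.add measurable_snd)).const_mul 2
    · refine Measurable.const_mul ?_ 2
      refine Measurable.lintegral_prod_right'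
        (f := fun w : (E3 × E3) × ℝ => ENNReal.ofReal (2 * ε) ^ 2 * q (w.1.1 + w.2 • w.1.2)) ?_
      exact (hqm.comp (by fun_prop)).const_mul _
  have key : ∀ z ∈ Ω, volume (Metric.ball (0 : E3) (δ * ε)) * ‖v z‖ₑ ^ 2 ≤
      ∫⁻ h in Metric.ball 0 (2 * ε), P z h := by
    intro z hz
    obtain ⟨y, hy, hzy⟩ := Metric.mem_thickening_iff.1 hz
    rw [dist_eq_norm] at hzy
    have hsub : Metric.ball (y - z) (δ * ε) ⊆ Metric.ball 0 (2 * ε) := by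
      intro h hh
      rw [Metric.mem_ball, dist_eq_norm] at hh ⊢
      calc ‖h - 0‖ = ‖(h - (y - z)) + (y - z)‖ := by congr 1; abel
        _ ≤ _ := norm_add_le _ _
        _ < δ * ε + ε := by rw [← norm_neg (y - z), neg_sub]; linarith
        _ ≤ 2 * ε := by linarith
    calc _ = ∫⁻ h in Metric.ball (y - z) (δ * ε), ‖v z‖ₑ ^ 2 := by
          rw [setLIntegral_const, mul_comm, Measure.addHaar_ball_center volume (y - z)]
      _ ≤ ∫⁻ h in Metric.ball (y - z) (δ * ε), P z h := by
          refine setLIntegral_mono' Metric.isOpen_ball.measurableSet fun h hh => ?_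
          have hh2 := hsub hh
          rw [Metric.mem_ball, dist_eq_norm] at hh
          rw [mem_ball_zero_iff] at hh2
          refine (enorm_sq_le_segment hv z h).trans ?_
          have hzh : ‖z + h - y‖ < δ * ε := by
            rw [show z + h - y = h - (y - z) by abel]; exact hh
          have h1 : z + h ∈ D := Metric.mem_thickening_iff.2 ⟨y, hy, by rwa [dist_eq_norm]⟩
          simp only [hP]
          rw [hp, indicator_of_mem h1]
          gcongr 2 * _ + 2 * ?_
          refine setLIntegral_mono' measurableSet_Icc fun t ht => ?_
          have h2 : z + t • h ∈ Ω := by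
            refine Metric.mem_thickening_iff.2 ⟨y, hy, ?_⟩
            have hc := (convex_ball y ε).add_smul_sub_mem (x := z) (y := z + h)
              (by rwa [Metric.mem_ball, dist_eq_norm])
              (by rw [Metric.mem_ball, dist_eq_norm]; linarith) ht
            simpa using hc
          rw [hq, indicator_of_mem h2]
          gcongr
          rw [← ofReal_norm]
          exact ENNReal.ofReal_le_ofReal hh2.le
      _ ≤ _ := lintegral_mono_set hsub
  calc _ = ∫⁻ z in Ω, volume (Metric.ball (0 : E3) (δ * ε)) * ‖v z‖ₑ ^ 2 := by
        rw [lintegral_const_mul _ ((hv.continuous.enorm.measurable).pow_const 2)]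
    _ ≤ ∫⁻ z in Ω, ∫⁻ h in Metric.ball 0 (2 * ε), P z h := setLIntegral_mono' hΩm key
    _ ≤ ∫⁻ z, ∫⁻ h in Metric.ball 0 (2 * ε), P z h := setLIntegral_le_lintegral _ _
    _ = ∫⁻ h in Metric.ball 0 (2 * ε), ∫⁻ z, P z h := lintegral_lintegral_swap hPm.aemeasurable
    _ = ∫⁻ h in Metric.ball (0 : E3) (2 * ε), (2 * (∫⁻ z in D, ‖v z‖ₑ ^ 2) +
          2 * (ENNReal.ofReal (2 * ε) ^ 2 * ∫⁻ z in Ω, ‖fderiv ℝ v z‖ₑ ^ 2)) := by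
        refine lintegral_congr fun h => ?_
        simp only [hP]
        have hph : Measurable fun z => p (z + h) := hpm.comp (measurable_add_const h)
        rw [lintegral_add_left (hph.const_mul 2), lintegral_const_mul _ hph,
          lintegral_add_right_eq_self p h, hp, lintegral_indicator hDm]
        congr 1
        have hm : Measurable fun w : E3 × ℝ =>
            ENNReal.ofReal (2 * ε) ^ 2 * q (w.1 + w.2 • h) :=
          (hqm.comp (by fun_prop)).const_mul _
        rw [lintegral_const_mul _ (Measurable.lintegral_prod_right' hm),
          lintegral_lintegral_swap hm.aemeasurable]
        congr 1
        have : ∀ t : ℝ, ∫⁻ z, ENNReal.ofReal (2 * ε) ^ 2 * q (z + t • h) =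
            ENNReal.ofReal (2 * ε) ^ 2 * ∫⁻ z in Ω, ‖fderiv ℝ v z‖ₑ ^ 2 := fun t => by
          have hqt : Measurable fun z => q (z + t • h) := hqm.comp (measurable_add_const _)
          rw [lintegral_const_mul _ hqt, lintegral_add_right_eq_self q, hq, lintegral_indicator hΩm]
        simp only [this, setLIntegral_const, Real.volume_Icc, sub_zero, ENNReal.ofReal_one, mul_one]
    _ = _ := by rw [setLIntegral_const, mul_comm]

/-- The `L²` norm over a uniform neighbourhood of an arbitrary set is controlled by the one over a
thinner neighbourhood and the gradient. -/
theorem lintegral_thickening_le_shrink {v : E3 → F} (hv : ContDiff ℝ 1 v) (A : Set E3) {ε δ : ℝ}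
    (hε : 0 < ε) (hδ : 0 < δ) (hδ1 : δ ≤ 1) :
    ∫⁻ z in Metric.thickening ε A, ‖v z‖ₑ ^ 2 ≤
      ENNReal.ofReal (8 * (2 / δ) ^ 3) * (∫⁻ z in Metric.thickening (δ * ε) A, ‖v z‖ₑ ^ 2) +
      ENNReal.ofReal (8 * (2 / δ) ^ 3 * ε ^ 2) *
        ∫⁻ z in Metric.thickening ε A, ‖fderiv ℝ v z‖ₑ ^ 2 := by
  have h := shrink_aux hv A hε hδ1
  have hfin : volume (Metric.ball (0 : E3) (δ * ε)) ≠ ⊤ := measure_ball_lt_top.ne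
  have hpos : volume (Metric.ball (0 : E3) (δ * ε)) ≠ 0 :=
    (Metric.measure_ball_pos _ _ (by positivity)).ne'
  -- The volume ratio in dimension three is the loss incurred by averaging over the small ball.
  have hvol : volume (Metric.ball (0 : E3) (2 * ε)) =
      volume (Metric.ball (0 : E3) (δ * ε)) * ENNReal.ofReal ((2 / δ) ^ 3) := by
    have : 2 * ε = (2 / δ) * (δ * ε) := by field_simp
    rw [this, Measure.addHaar_ball_mul_of_pos _ _ (by positivity), mul_comm]
    simp
  rw [hvol, mul_assoc, ENNReal.mul_le_mul_iff_right hpos hfin] at h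
  refine h.trans ?_
  rw [mul_add]
  have h0 : (0 : ℝ) ≤ (2 / δ) ^ 3 := by positivity
  gcongr ?_ + ?_
  · rw [← mul_assoc]
    gcongr
    rw [← ENNReal.ofReal_ofNat 2, ← ENNReal.ofReal_mul h0]
    exact ENNReal.ofReal_le_ofReal (by linarith)
  · rw [← mul_assoc, ← mul_assoc]
    gcongr
    rw [← ENNReal.ofReal_ofNat 2, ← ENNReal.ofReal_mul h0, ← ENNReal.ofReal_pow (by positivity),
      ← ENNReal.ofReal_mul (by positivity)]
    exact ENNReal.ofReal_le_ofReal (by nlinarith)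

end Shrink

/-! ### Lipschitz changes of variables and integration over a slab. -/

section ChangeOfVariables

open scoped NNReal

/-- Volume is a constant multiple of three-dimensional Hausdorff measure, which scales by `L ^ 3`.
-/
theorem volume_image_le_of_lipschitzOnWith {g : E3 → E3} {s : Set E3} {L : ℝ≥0}
    (hg : LipschitzOnWith L g s) : volume (g '' s) ≤ (L : ℝ≥0∞) ^ 3 * volume s := by
  have hfr : Module.finrank ℝ E3 = 3 := by simp
  have hvol := Measure.isAddLeftInvariant_eq_smul (volume : Measure E3)
    (Measure.hausdorffMeasure (Module.finrank ℝ E3 : ℝ))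
  rw [hvol, Measure.smul_apply, Measure.smul_apply, mul_smul_comm]
  gcongr
  have := hg.hausdorffMeasure_image_le (d := (Module.finrank ℝ E3 : ℝ)) (by positivity)
  refine this.trans (le_of_eq ?_)
  rw [hfr]
  norm_cast

/-- The pushforward of volume on `s` under `f` is at most `L ^ 3` times volume, because preimages
under `f` are images under its Lipschitz left inverse. No Jacobian is needed. -/
theorem lintegral_comp_le_of_lipschitzOnWith {f g : E3 → E3} {s : Set E3} (hs : MeasurableSet s)
    (hf : ContinuousOn f s) {L : ℝ≥0} (hg : LipschitzOnWith L g (f '' s)) (hgf : LeftInvOn g f s)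
    {F : E3 → ℝ≥0∞} (hF : Measurable F) :
    ∫⁻ z in s, F (f z) ≤ (L : ℝ≥0∞) ^ 3 * ∫⁻ w, F w := by
  have hfm : AEMeasurable f (volume.restrict s) := hf.aemeasurable hs
  have hle : Measure.map f (volume.restrict s) ≤ (L : ℝ≥0∞) ^ 3 • (volume : Measure E3) := by
    refine Measure.le_iff.2 fun B hB => ?_
    rw [Measure.map_apply_of_aemeasurable hfm hB, Measure.restrict_apply' hs, Measure.smul_apply,
      smul_eq_mul]
    have hsub : f ⁻¹' B ∩ s ⊆ g '' (f '' s ∩ B) := fun z hz =>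
      ⟨f z, ⟨mem_image_of_mem f hz.2, hz.1⟩, hgf hz.2⟩
    calc _ ≤ volume (g '' (f '' s ∩ B)) := measure_mono hsub
      _ ≤ (L : ℝ≥0∞) ^ 3 * volume (f '' s ∩ B) :=
        volume_image_le_of_lipschitzOnWith (hg.mono inter_subset_left)
      _ ≤ _ := by gcongr; exact inter_subset_right
  calc _ = ∫⁻ w, F w ∂(Measure.map f (volume.restrict s)) :=
        (lintegral_map' hF.aemeasurable hfm).symm
    _ ≤ ∫⁻ w, F w ∂((L : ℝ≥0∞) ^ 3 • (volume : Measure E3)) := lintegral_mono' hle le_rfl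
    _ = _ := by rw [lintegral_smul_measure, smul_eq_mul]

end ChangeOfVariables

/-- A point leaves a slab along the direction orthogonal to it within a time comparable to the
thickness of the slab. -/
theorem lintegral_slab_le {F : E3 → ℝ≥0∞} (hF : Measurable F) (i : Fin 3) (c R : ℝ) :
    ∫⁻ w in {w : E3 | |w i| < c}, ∫⁻ t in Icc 0 R, F (w + t • EuclideanSpace.single i (1 : ℝ)) ≤
      ENNReal.ofReal (2 * c) * ∫⁻ w, F w := by
  set e : E3 := EuclideanSpace.single i (1 : ℝ) with he
  set S : Set E3 := {w : E3 | |w i| < c} with hS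
  have hSm : MeasurableSet S :=
    (isOpen_lt (by fun_prop) continuous_const).measurableSet
  set χ : E3 → ℝ≥0∞ := S.indicator 1 with hχ
  have hχm : Measurable χ := measurable_one.indicator hSm
  have hmul : ∀ w, χ w * (∫⁻ t in Icc 0 R, F (w + t • e)) =
      S.indicator (fun w => ∫⁻ t in Icc 0 R, F (w + t • e)) w := fun w => by
    by_cases hw : w ∈ S <;> simp [hχ, hw]
  have hm1 : Measurable fun p : E3 × ℝ => χ p.1 * F (p.1 + p.2 • e) :=
    (hχm.comp measurable_fst).mul (hF.comp (by fun_prop))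
  have hm2 : Measurable fun p : ℝ × E3 => χ (p.2 - p.1 • e) * F p.2 :=
    (hχm.comp (by fun_prop)).mul (hF.comp measurable_snd)
  calc _ = ∫⁻ w, ∫⁻ t in Icc 0 R, χ w * F (w + t • e) := by
        rw [← lintegral_indicator hSm]
        refine lintegral_congr fun w => ?_
        have hFt : Measurable fun t : ℝ => F (w + t • e) := hF.comp (by fun_prop)
        rw [← hmul, lintegral_const_mul _ hFt]
    _ = ∫⁻ t in Icc 0 R, ∫⁻ w, χ w * F (w + t • e) := lintegral_lintegral_swap hm1.aemeasurable
    _ = ∫⁻ t in Icc 0 R, ∫⁻ w, χ (w - t • e) * F w := by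
        refine lintegral_congr fun t => ?_
        rw [← lintegral_sub_right_eq_self (fun w => χ w * F (w + t • e)) (t • e)]
        simp
    _ = ∫⁻ w, ∫⁻ t in Icc 0 R, χ (w - t • e) * F w := lintegral_lintegral_swap hm2.aemeasurable
    -- For fixed `w`, the times `t` with `w - t • e` in the slab form the interval of radius `c`
    -- about `w i`.
    _ ≤ ∫⁻ w, ENNReal.ofReal (2 * c) * F w := by
        refine lintegral_mono fun w => ?_
        have hχt : Measurable fun t : ℝ => χ (w - t • e) := hχm.comp (by fun_prop)
        rw [lintegral_mul_const _ hχt]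
        gcongr
        calc _ ≤ ∫⁻ t, χ (w - t • e) := setLIntegral_le_lintegral _ _
          _ = ∫⁻ t, (Metric.ball (w i) c).indicator 1 t := by
            refine lintegral_congr fun t => ?_
            have : w - t • e ∈ S ↔ t ∈ Metric.ball (w i) c := by
              simp [hS, he, Real.dist_eq, abs_sub_comm]
            by_cases ht : t ∈ Metric.ball (w i) c
            · rw [hχ, indicator_of_mem (this.2 ht), indicator_of_mem ht]; rfl
            · rw [hχ, indicator_of_notMem (fun h => ht (this.1 h)), indicator_of_notMem ht]
          _ = _ := by rw [lintegral_indicator_one Metric.isOpen_ball.measurableSet,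
                        Real.volume_ball]
    _ = _ := lintegral_const_mul _ hF

/-! ### The estimate in a chart around a boundary point. -/

section Chart

open scoped NNReal Topology

/-- On small balls a smooth chart and its inverse are Lipschitz, and map into each other. -/
theorem IsSmoothChart.exists_lipschitz_balls {Φ : OpenPartialHomeomorph E3 E3}
    (hΦ : IsSmoothChart Φ) {U : Set E3} (hU : IsOpen U) (hUs : U ⊆ Φ.source) {x : E3} (hx : x ∈ U) :
    ∃ (L : ℝ≥0) (R r : ℝ), 1 ≤ L ∧ 0 < R ∧ 0 < r ∧
      LipschitzOnWith L Φ (Metric.ball x (2 * r)) ∧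
      MapsTo Φ (Metric.ball x (2 * r)) (Metric.ball (Φ x) R) ∧ Metric.ball x (2 * r) ⊆ U ∧
      LipschitzOnWith L Φ.symm (Metric.ball (Φ x) (2 * R)) ∧
      MapsTo Φ.symm (Metric.ball (Φ x) (2 * R)) U ∧
      LipschitzOnWith L Φ (Φ.symm '' Metric.ball (Φ x) (2 * R)) ∧
      Metric.ball (Φ x) (2 * R) ⊆ Φ.target := by
  have hxs := hUs hx
  have hxt := Φ.map_source hxs
  obtain ⟨K₁, t₁, ht₁, hK₁⟩ := ((hΦ.1.contDiffAt (Φ.open_source.mem_nhds hxs)).of_le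
    (m := 1) (by simp)).exists_lipschitzOnWith
  obtain ⟨K₂, t₂, ht₂, hK₂⟩ := ((hΦ.2.contDiffAt (Φ.open_target.mem_nhds hxt)).of_le
    (m := 1) (by simp)).exists_lipschitzOnWith
  have hV : t₁ ∩ U ∈ 𝓝 x := Filter.inter_mem ht₁ (hU.mem_nhds hx)
  -- Pulling back `t₁` as well makes `Φ` Lipschitz on the image under `Φ.symm` of the target ball.
  have hW : Φ.symm ⁻¹' (t₁ ∩ U) ∩ t₂ ∩ Φ.target ∈ 𝓝 (Φ x) := by
    refine Filter.inter_mem (Filter.inter_mem ?_ ht₂) (Φ.open_target.mem_nhds hxt)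
    refine (Φ.continuousAt_symm hxt).preimage_mem_nhds ?_
    rwa [Φ.left_inv hxs]
  obtain ⟨R, hR, hRW⟩ := Metric.mem_nhds_iff.1 hW
  have hV' : Φ ⁻¹' Metric.ball (Φ x) (R / 2) ∩ (t₁ ∩ U) ∈ 𝓝 x :=
    Filter.inter_mem ((Φ.continuousAt hxs).preimage_mem_nhds
      (Metric.ball_mem_nhds _ (by positivity))) hV
  obtain ⟨r, hr, hrV⟩ := Metric.mem_nhds_iff.1 hV'
  refine ⟨max 1 (max K₁ K₂), R / 2, r / 2, le_max_left _ _, by positivity, by positivity, ?_⟩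
  rw [mul_div_cancel₀ r two_ne_zero, mul_div_cancel₀ R two_ne_zero]
  have h1 : K₁ ≤ max 1 (max K₁ K₂) := (le_max_left _ _).trans (le_max_right _ _)
  have h2 : K₂ ≤ max 1 (max K₁ K₂) := (le_max_right _ _).trans (le_max_right _ _)
  refine ⟨(hK₁.mono fun z hz => (hrV hz).2.1).weaken h1, fun z hz => (hrV hz).1,
    fun z hz => (hrV hz).2.2, (hK₂.mono fun z hz => (hRW hz).1.2).weaken h2,
    fun z hz => (hRW hz).1.1.2, ?_, fun z hz => (hRW hz).2⟩
  refine (hK₁.mono ?_).weaken h1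
  rintro _ ⟨z, hz, rfl⟩
  exact (hRW hz).1.1.1

variable {F : Type*} [NormedAddCommGroup F] [NormedSpace ℝ F] [CompleteSpace F]

/-- The trace estimate along a coordinate line of a chart. -/
theorem enorm_sq_le_coordinate_line {Ψ : OpenPartialHomeomorph E3 E3}
    (hΨ : ContDiffOn ℝ ∞ Ψ Ψ.source) {L : ℝ≥0} {B : Set E3} (hB : IsOpen B) (hBs : B ⊆ Ψ.source)
    (hL : LipschitzOnWith L Ψ B) {v : E3 → F} (hv : ContDiff ℝ 1 v) {w e : E3} (he : ‖e‖ = 1)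
    {R : ℝ} (hw : ∀ t ∈ Icc 0 R, w + t • e ∈ B) :
    ENNReal.ofReal R * ‖v (Ψ w)‖ₑ ^ 2 ≤ ∫⁻ t in Icc 0 R, (2 * ‖v (Ψ (w + t • e))‖ₑ ^ 2 +
      2 * ENNReal.ofReal R ^ 2 * (L : ℝ≥0∞) ^ 2 * ‖fderiv ℝ v (Ψ (w + t • e))‖ₑ ^ 2) := by
  have hline : Continuous fun t : ℝ => w + t • e := by fun_prop
  have hcB : ContinuousOn (fun t : ℝ => Ψ (w + t • e)) (Icc 0 R) :=
    (Ψ.continuousOn.mono hBs).comp hline.continuousOn hw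
  have hdΨ : ∀ p ∈ B, HasFDerivAt Ψ (fderiv ℝ Ψ p) p := fun p hp =>
    ((hΨ.contDiffAt (Ψ.open_source.mem_nhds (hBs hp))).differentiableAt (by simp)).hasFDerivAt
  have hd : ∀ t ∈ Icc 0 R, HasDerivAt (fun t : ℝ => v (Ψ (w + t • e)))
      (fderiv ℝ v (Ψ (w + t • e)) (fderiv ℝ Ψ (w + t • e) e)) t := fun t ht => by
    have h1 : HasDerivAt (fun t : ℝ => w + t • e) e t := by
      simpa using ((hasDerivAt_id t).smul_const e).const_add w
    exact ((hv.differentiable one_ne_zero) _).hasFDerivAt.comp_hasDerivAt t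
      ((hdΨ _ (hw t ht)).comp_hasDerivAt t h1)
  have hcv : ContinuousOn (fun t : ℝ => fderiv ℝ v (Ψ (w + t • e))) (Icc 0 R) :=
    (hv.continuous_fderiv one_ne_zero).comp_continuousOn hcB
  have hcd : ContinuousOn (fun t : ℝ =>
      fderiv ℝ v (Ψ (w + t • e)) (fderiv ℝ Ψ (w + t • e) e)) (Icc 0 R) := by
    refine hcv.clm_apply (ContinuousOn.clm_apply ?_ continuousOn_const)
    exact ((hΨ.continuousOn_fderiv_of_isOpen Ψ.open_source (by simp)).mono hBs).comp
      hline.continuousOn hw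
  have hbound : ∀ t ∈ Icc 0 R, ‖fderiv ℝ v (Ψ (w + t • e)) (fderiv ℝ Ψ (w + t • e) e)‖ₑ ^ 2 ≤
      (L : ℝ≥0∞) ^ 2 * ‖fderiv ℝ v (Ψ (w + t • e))‖ₑ ^ 2 := fun t ht => by
    rw [← mul_pow, mul_comm (L : ℝ≥0∞)]
    refine pow_le_pow_left₀ zero_le ((ContinuousLinearMap.le_opENorm _ _).trans ?_) 2
    gcongr
    have h2 : ‖fderiv ℝ Ψ (w + t • e) e‖ ≤ L := by
      refine (ContinuousLinearMap.le_opNorm _ _).trans ?_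
      rw [he, mul_one]
      exact norm_fderiv_le_of_lipschitzOn ℝ (hB.mem_nhds (hw t ht)) hL
    rw [← ofReal_norm, ← ENNReal.ofReal_coe_nnreal]
    exact ENNReal.ofReal_le_ofReal h2
  set I : ℝ≥0∞ := ∫⁻ t in Icc 0 R, ‖fderiv ℝ v (Ψ (w + t • e))‖ₑ ^ 2 with hI
  have hcm : AEMeasurable (fun t : ℝ => ‖fderiv ℝ v (Ψ (w + t • e))‖ₑ ^ 2)
      (volume.restrict (Icc 0 R)) :=
    ((hcv.aestronglyMeasurable measurableSet_Icc).enorm).pow_const 2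
  have hpt : ∀ s ∈ Icc 0 R, ‖v (Ψ w)‖ₑ ^ 2 ≤ 2 * ‖v (Ψ (w + s • e))‖ₑ ^ 2 +
      2 * (ENNReal.ofReal R * ((L : ℝ≥0∞) ^ 2 * I)) := fun s hs => by
    have h := enorm_sq_le_trace hs hd hcd
    simp only [zero_smul, add_zero] at h
    refine h.trans ?_
    gcongr
    calc _ ≤ ∫⁻ t in Icc 0 R, (L : ℝ≥0∞) ^ 2 * ‖fderiv ℝ v (Ψ (w + t • e))‖ₑ ^ 2 :=
          setLIntegral_mono' measurableSet_Icc hbound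
      _ = _ := lintegral_const_mul'' _ hcm
  have hvm : AEMeasurable (fun t : ℝ => 2 * ‖v (Ψ (w + t • e))‖ₑ ^ 2)
      (volume.restrict (Icc 0 R)) :=
    ((((hv.continuous.comp_continuousOn hcB).aestronglyMeasurable
      measurableSet_Icc).enorm).pow_const 2).const_mul 2
  calc _ = ∫⁻ s in Icc 0 R, ‖v (Ψ w)‖ₑ ^ 2 := by
        rw [setLIntegral_const, Real.volume_Icc, sub_zero, mul_comm]
    _ ≤ ∫⁻ s in Icc 0 R, (2 * ‖v (Ψ (w + s • e))‖ₑ ^ 2 +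
      2 * (ENNReal.ofReal R * ((L : ℝ≥0∞) ^ 2 * I))) := setLIntegral_mono' measurableSet_Icc hpt
    _ = _ := by
      rw [lintegral_add_left' hvm, lintegral_add_left' hvm, lintegral_const_mul'' _ hcm,
        setLIntegral_const, Real.volume_Icc, sub_zero]
      ring

/-- The estimate near a boundary point of a single half-surface. -/
theorem IsHalfSurfaceIn.exists_lintegral_le {U H E : Set E3} (hU : IsOpen U) {x : E3} (hx : x ∈ U)
    (hH : IsHalfSurfaceIn U H E) {b : ℝ} (hb : 0 < b) :
    ∃ r > 0, ∃ δ > 0, ∃ ε₀ > 0, ∃ C > 0, ∀ ε, 0 < ε → ε < ε₀ → ∀ v : E3 → F, ContDiff ℝ 1 v →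
      ∫⁻ z in Metric.thickening (δ * ε) (H ∩ Metric.ball x r ∩ Metric.thickening (b * ε) E),
        ‖v z‖ₑ ^ 2 ≤ ENNReal.ofReal (C * ε) *
          ((∫⁻ z in Metric.thickening ε (H ∩ U), ‖v z‖ₑ ^ 2) +
            ∫⁻ z in Metric.thickening ε (H ∩ U), ‖fderiv ℝ v z‖ₑ ^ 2) := by
  obtain ⟨Φ, hΦ, hUs, hHE⟩ := hH
  obtain ⟨L, R, r, hL1, hR, hr, hΦL, hΦB, hrU, hΨL, hΨU, hΦL', hRt⟩ :=
    hΦ.exists_lipschitz_balls hU hUs hx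
  have hL1' : (1 : ℝ) ≤ L := by exact_mod_cast hL1
  have hL0 : (0 : ℝ) < L := by linarith
  set e : E3 := EuclideanSpace.single 1 (1 : ℝ) with he
  have hen : ‖e‖ = 1 := by simp [he]
  -- A point considered is within `(b + 1) * ε` of some point of the edge, where coordinate `1`
  -- vanishes; the chart multiplies this by at most `L`.
  set c : ℝ := L * (b + 1) with hc
  have hc0 : 0 < c := by positivity
  -- Going into the chart and back expands distances by at most `L ^ 2`, so `δ * ε` becomes at most
  -- `ε / 2`.
  set δ : ℝ := 1 / (2 * L ^ 2) with hδ
  have hδ0 : 0 < δ := by positivity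
  have hδL : δ * L ^ 2 = 1 / 2 := by rw [hδ]; field_simp
  have hδ1 : δ ≤ 1 := by
    have : (1 : ℝ) ≤ (L : ℝ) ^ 2 := one_le_pow₀ hL1'
    nlinarith
  -- The bounds `ε < r` and `b * ε < r` keep `z` and its nearby edge point in the ball of radius `2
  -- * r`.
  refine ⟨r, hr, δ, hδ0, min r (r / b), lt_min hr (by positivity),
    2 * c * L ^ 6 * (2 + 2 * R ^ 2 * L ^ 2) / R, by positivity, ?_⟩
  intro ε hε hε₀ v hv
  have hεr : ε < r := hε₀.trans_le (min_le_left _ _)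
  have hbεr : b * ε < r := by
    have := hε₀.trans_le (min_le_right _ _)
    rwa [lt_div_iff₀ hb, mul_comm] at this
  set Ω := Metric.thickening ε (H ∩ U) with hΩ
  set B := Metric.ball (Φ x) (2 * R) with hB
  set S := Metric.thickening (δ * ε) (H ∩ Metric.ball x r ∩ Metric.thickening (b * ε) E) with hS
  have hSo : IsOpen S := Metric.isOpen_thickening
  have hBo : IsOpen B := Metric.isOpen_ball
  have hΩm : MeasurableSet Ω := Metric.isOpen_thickening.measurableSet
  set W : Set E3 := B ∩ Φ.symm ⁻¹' Ω with hW
  have hWo : IsOpen W :=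
    (Φ.continuousOn_symm.mono hRt).isOpen_inter_preimage hBo Metric.isOpen_thickening
  set h : E3 → ℝ≥0∞ := fun z => 2 * ‖v z‖ₑ ^ 2 +
    2 * ENNReal.ofReal R ^ 2 * (L : ℝ≥0∞) ^ 2 * ‖fderiv ℝ v z‖ₑ ^ 2 with hh
  have hvm : Measurable fun z => ‖v z‖ₑ ^ 2 := (hv.continuous.enorm.measurable).pow_const 2
  have hdm : Measurable fun z => ‖fderiv ℝ v z‖ₑ ^ 2 :=
    ((hv.continuous_fderiv one_ne_zero).enorm.measurable).pow_const 2
  have hhc : Continuous h := by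
    have h1 : Continuous fun z => ‖v z‖ₑ ^ 2 := by
      exact (ENNReal.continuous_pow 2).comp hv.continuous.enorm
    have h2 : Continuous fun z => ‖fderiv ℝ v z‖ₑ ^ 2 :=
      (ENNReal.continuous_pow 2).comp (hv.continuous_fderiv one_ne_zero).enorm
    refine ((ENNReal.continuous_const_mul (by simp)).comp h1).add
      ((ENNReal.continuous_const_mul ?_).comp h2)
    finiteness
  set G : E3 → ℝ≥0∞ := W.indicator fun w => h (Φ.symm w) with hG
  have hGm : Measurable G := by
    classical
    rw [hG, ← piecewise_eq_indicator]
    refine ContinuousOn.measurable_piecewise ?_ continuousOn_const hWo.measurableSet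
    exact hhc.comp_continuousOn (Φ.continuousOn_symm.mono (inter_subset_left.trans hRt))
  -- the geometry of the chart
  have hgeo : ∀ z ∈ S, z ∈ Metric.ball x (2 * r) ∧ |Φ z 1| < c * ε ∧
      ∀ t ∈ Icc 0 R, Φ z + t • e ∈ W := by
    intro z hz
    obtain ⟨y, ⟨⟨hyH, hyx⟩, hyE⟩, hzy⟩ := Metric.mem_thickening_iff.1 hz
    obtain ⟨p, hpE, hyp⟩ := Metric.mem_thickening_iff.1 hyE
    rw [Metric.mem_ball] at hyx
    have hδε : δ * ε ≤ ε := by nlinarith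
    have hz2 : z ∈ Metric.ball x (2 * r) := by
      rw [Metric.mem_ball]; linarith [dist_triangle z y x]
    have hy2 : y ∈ Metric.ball x (2 * r) := by rw [Metric.mem_ball]; linarith
    have hp2 : p ∈ Metric.ball x (2 * r) := by
      rw [Metric.mem_ball]; linarith [dist_triangle p y x, dist_comm p y]
    have hyc := ((hHE y (hrU hy2)).1).1 hyH
    have hpc := ((hHE p (hrU hp2)).2).1 hpE
    have hzyΦ : dist (Φ z) (Φ y) ≤ L * (δ * ε) :=
      (hΦL.dist_le_mul _ hz2 _ hy2).trans (by gcongr)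
    have hzpΦ : dist (Φ z) (Φ p) < c * ε := by
      have h1 : dist z p < (b + 1) * ε := by linarith [dist_triangle z y p]
      calc _ ≤ L * dist z p := hΦL.dist_le_mul _ hz2 _ hp2
        _ < L * ((b + 1) * ε) := by gcongr
        _ = _ := by rw [hc]; ring
    have hcoord : |Φ z 1| ≤ dist (Φ z) (Φ p) := by
      have := PiLp.norm_apply_le (Φ z - Φ p) 1
      rw [dist_eq_norm]
      simpa [hpc.1] using this
    refine ⟨hz2, hcoord.trans_lt hzpΦ, fun t ht => ?_⟩
    have hline : ∀ w ∈ Metric.ball (Φ x) R, w + t • e ∈ B := fun w hw => by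
      rw [hB, Metric.mem_ball, dist_eq_norm] at *
      calc ‖w + t • e - Φ x‖ = ‖(w - Φ x) + t • e‖ := by congr 1; abel
        _ ≤ ‖w - Φ x‖ + ‖t • e‖ := norm_add_le _ _
        _ < R + R := by
          rw [norm_smul, hen, mul_one, Real.norm_of_nonneg ht.1]
          linarith [ht.2]
        _ = 2 * R := by ring
    have hzB := hline _ (hΦB hz2)
    have hyB := hline _ (hΦB hy2)
    refine ⟨hzB, ?_⟩
    have hyU := hΨU hyB
    rw [mem_preimage, hΩ, Metric.mem_thickening_iff]
    -- Shift the base point `y` along with `z`: for `t ≥ 0` the translate stays in the half-plane,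
    -- hence in `H`.
    refine ⟨Φ.symm (Φ y + t • e), ⟨?_, hyU⟩, ?_⟩
    · refine ((hHE _ hyU).1).2 ?_
      rw [Φ.right_inv (hRt hyB)]
      constructor
      · simpa [he] using add_nonneg hyc.1 ht.1
      · simpa [he] using hyc.2
    · calc _ ≤ L * dist (Φ z + t • e) (Φ y + t • e) := hΨL.dist_le_mul _ hzB _ hyB
        _ ≤ L * (L * (δ * ε)) := by rw [dist_add_right]; gcongr
        _ = (δ * L ^ 2) * ε := by ring
        _ < ε := by rw [hδL]; linarith
  have hSr : S ⊆ Metric.ball x (2 * r) := fun z hz => (hgeo z hz).1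
  have hSs : S ⊆ Φ.source := hSr.trans (hrU.trans hUs)
  set Q : Set E3 := {w : E3 | |w 1| < c * ε} with hQ
  have hQm : MeasurableSet Q := (isOpen_lt (by fun_prop) continuous_const).measurableSet
  set K : E3 → ℝ≥0∞ := Q.indicator fun w => ∫⁻ t in Icc 0 R, G (w + t • e) with hK
  have hKm : Measurable K := by
    refine Measurable.indicator ?_ hQm
    exact Measurable.lintegral_prod_right' (f := fun p : E3 × ℝ => G (p.1 + p.2 • e))
      (hGm.comp (by fun_prop))
  have hpt : ∀ z ∈ S, ENNReal.ofReal R * ‖v z‖ₑ ^ 2 ≤ K (Φ z) := by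
    intro z hz
    obtain ⟨-, hz1, hzt⟩ := hgeo z hz
    have := enorm_sq_le_coordinate_line (Ψ := Φ.symm) hΦ.2 hBo hRt hΨL hv hen (w := Φ z) (R := R)
      (fun t ht => (hzt t ht).1)
    rw [Φ.left_inv (hSs hz)] at this
    refine this.trans ?_
    rw [hK, indicator_of_mem (by exact hz1)]
    refine setLIntegral_mono' measurableSet_Icc fun t ht => ?_
    rw [hG, indicator_of_mem (hzt t ht)]
  have hΨΦ : MapsTo Φ S B := fun z hz =>
    Metric.ball_subset_ball (by linarith) (hΦB (hSr hz))
  -- Each passage into or out of the chart costs `L ^ 3`; the slab in between supplies the factor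
  -- `ε`.
  have hmain : ENNReal.ofReal R * ∫⁻ z in S, ‖v z‖ₑ ^ 2 ≤ (L : ℝ≥0∞) ^ 3 *
      (ENNReal.ofReal (2 * (c * ε)) * ((L : ℝ≥0∞) ^ 3 * ∫⁻ z in Ω, h z)) :=
    calc _ = ∫⁻ z in S, ENNReal.ofReal R * ‖v z‖ₑ ^ 2 := (lintegral_const_mul _ hvm).symm
      _ ≤ ∫⁻ z in S, K (Φ z) := setLIntegral_mono' hSo.measurableSet hpt
      _ ≤ (L : ℝ≥0∞) ^ 3 * ∫⁻ w, K w :=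
        lintegral_comp_le_of_lipschitzOnWith hSo.measurableSet (Φ.continuousOn.mono hSs)
          (hΨL.mono hΨΦ.image_subset) (fun z hz => Φ.left_inv (hSs hz)) hKm
      _ ≤ _ := by
        gcongr
        rw [hK, lintegral_indicator hQm]
        refine (lintegral_slab_le hGm 1 (c * ε) R).trans ?_
        gcongr
        rw [hG, lintegral_indicator hWo.measurableSet, ← lintegral_indicator hΩm]
        calc _ = ∫⁻ w in W, Ω.indicator h (Φ.symm w) :=
              setLIntegral_congr_fun hWo.measurableSet fun w hw => by
                exact (indicator_of_mem (s := Ω) hw.2 h).symm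
          _ ≤ _ := lintegral_comp_le_of_lipschitzOnWith hWo.measurableSet
              (Φ.continuousOn_symm.mono (inter_subset_left.trans hRt))
              (hΦL'.mono (image_mono inter_subset_left))
              (fun w hw => Φ.right_inv (hRt hw.1)) (hhc.measurable.indicator hΩm)
  have hint : ∫⁻ z in Ω, h z ≤ ENNReal.ofReal (2 + 2 * R ^ 2 * L ^ 2) *
      ((∫⁻ z in Ω, ‖v z‖ₑ ^ 2) + ∫⁻ z in Ω, ‖fderiv ℝ v z‖ₑ ^ 2) := by
    rw [hh, lintegral_add_left (hvm.const_mul 2), lintegral_const_mul _ hvm,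
      lintegral_const_mul _ hdm, mul_add]
    have h2 : 2 * ENNReal.ofReal R ^ 2 * (L : ℝ≥0∞) ^ 2 =
        ENNReal.ofReal (2 * R ^ 2 * L ^ 2) := by
      rw [ENNReal.ofReal_mul (by positivity), ENNReal.ofReal_mul (by positivity),
        ENNReal.ofReal_pow hR.le, ENNReal.ofReal_pow hL0.le, ENNReal.ofReal_coe_nnreal,
        ENNReal.ofReal_ofNat]
    have h3 : (2 : ℝ≥0∞) ≤ ENNReal.ofReal (2 + 2 * R ^ 2 * L ^ 2) := by
      rw [← ENNReal.ofReal_ofNat 2]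
      refine ENNReal.ofReal_le_ofReal ?_
      have : 0 ≤ 2 * R ^ 2 * (L : ℝ) ^ 2 := by positivity
      linarith
    rw [h2]
    gcongr
    linarith
  have hRe : ENNReal.ofReal R ≠ 0 := by simpa using hR
  rw [← ENNReal.mul_le_mul_iff_right hRe ENNReal.ofReal_ne_top]
  refine hmain.trans ?_
  calc _ ≤ (L : ℝ≥0∞) ^ 3 * (ENNReal.ofReal (2 * (c * ε)) * ((L : ℝ≥0∞) ^ 3 *
        (ENNReal.ofReal (2 + 2 * R ^ 2 * L ^ 2) *
          ((∫⁻ z in Ω, ‖v z‖ₑ ^ 2) + ∫⁻ z in Ω, ‖fderiv ℝ v z‖ₑ ^ 2)))) := by gcongr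
    _ = _ := by
      rw [← ENNReal.ofReal_coe_nnreal, ← ENNReal.ofReal_pow hL0.le]
      simp only [← mul_assoc]
      congr 1
      rw [← ENNReal.ofReal_mul (by positivity), ← ENNReal.ofReal_mul (by positivity),
        ← ENNReal.ofReal_mul (by positivity), ← ENNReal.ofReal_mul (by positivity)]
      congr 1
      field_simp

end Chart

/-! ### From local estimates to a whole compact binding. -/

section Compactness

variable {F : Type*} [NormedAddCommGroup F] [NormedSpace ℝ F]

variable (F) in
/-- For small `ε`, the squared `L²` norm of a `C¹` function over some `δ ε`-neighbourhood of the
part of `N` near `E` is `O(ε)` times its squared `H¹` norm over the `ε`-neighbourhood of `M`. -/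
def ThinEstimate (M E : Set E3) (b : ℝ) (N : Set E3) : Prop :=
  ∃ δ > 0, ∃ ε₀ > 0, ∃ C > 0, ∀ ε, 0 < ε → ε < ε₀ → ∀ v : E3 → F, ContDiff ℝ 1 v →
    ∫⁻ z in Metric.thickening (δ * ε) (N ∩ Metric.thickening (b * ε) E), ‖v z‖ₑ ^ 2 ≤
      ENNReal.ofReal (C * ε) * ((∫⁻ z in Metric.thickening ε M, ‖v z‖ₑ ^ 2) +
        ∫⁻ z in Metric.thickening ε M, ‖fderiv ℝ v z‖ₑ ^ 2)

theorem ThinEstimate.mono {M E N N' : Set E3} {b : ℝ} (h : ThinEstimate F M E b N)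
    (hN : N' ⊆ N) : ThinEstimate F M E b N' := by
  obtain ⟨δ, hδ, ε₀, hε₀, C, hC, h⟩ := h
  refine ⟨δ, hδ, ε₀, hε₀, C, hC, fun ε h0 h1 v hv => le_trans ?_ (h ε h0 h1 v hv)⟩
  exact lintegral_mono_set (Metric.thickening_subset_of_subset _ (inter_subset_inter_left _ hN))

theorem ThinEstimate.empty (M E : Set E3) (b : ℝ) : ThinEstimate F M E b ∅ :=
  ⟨1, one_pos, 1, one_pos, 1, one_pos, fun ε _ _ v _ => by simp⟩

theorem ThinEstimate.union {M E N N' : Set E3} {b : ℝ} (h : ThinEstimate F M E b N)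
    (h' : ThinEstimate F M E b N') : ThinEstimate F M E b (N ∪ N') := by
  obtain ⟨δ, hδ, ε₀, hε₀, C, hC, h⟩ := h
  obtain ⟨δ', hδ', ε₀', hε₀', C', hC', h'⟩ := h'
  refine ⟨min δ δ', lt_min hδ hδ', min ε₀ ε₀', lt_min hε₀ hε₀', C + C', by positivity,
    fun ε h0 h1 v hv => ?_⟩
  rw [union_inter_distrib_right, Metric.thickening_union, add_mul,
    ENNReal.ofReal_add (by positivity) (by positivity), add_mul]
  refine (lintegral_union_le _ _ _).trans ?_
  gcongr ?_ + ?_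
  · refine le_trans (lintegral_mono_set (Metric.thickening_mono ?_ _))
      (h ε h0 (h1.trans_le (min_le_left _ _)) v hv)
    gcongr
    exact min_le_left _ _
  · refine le_trans (lintegral_mono_set (Metric.thickening_mono ?_ _))
      (h' ε h0 (h1.trans_le (min_le_right _ _)) v hv)
    gcongr
    exact min_le_right _ _

theorem ThinEstimate.iUnion {M E : Set E3} {b : ℝ} {ι : Type*} [Finite ι] {N : ι → Set E3}
    (h : ∀ i, ThinEstimate F M E b (N i)) : ThinEstimate F M E b (⋃ i, N i) := by
  classical
  cases nonempty_fintype ι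
  have : ∀ s : Finset ι, ThinEstimate F M E b (⋃ i ∈ s, N i) := fun s => by
    induction s using Finset.induction_on with
    | empty => simpa using ThinEstimate.empty M E b
    | insert i s _ ih => rw [Finset.set_biUnion_insert]; exact (h i).union ih
  simpa using this Finset.univ

variable [CompleteSpace F]

/-- The half-surfaces can be treated one at a time: near `x` they cover `M`, and the neighbourhood
of each one within `U` lies in that of `M`. -/
theorem IsOpenBookNear.exists_thinEstimate {M E : Set E3} {x : E3} (h : IsOpenBookNear M E x)
    {b : ℝ} (hb : 0 < b) : ∃ V, IsOpen V ∧ x ∈ V ∧ ThinEstimate F M E b (M ∩ V) := by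
  obtain ⟨U, hU, hxU, n, -, H, hMU, hH, -⟩ := h
  choose r hr δ hδ ε₀ hε₀ C hC hest using fun i =>
    (hH i).exists_lintegral_le (F := F) hU hxU hb
  refine ⟨U ∩ ⋂ i, Metric.ball x (r i),
    hU.inter (isOpen_iInter_of_finite fun i => Metric.isOpen_ball),
    ⟨hxU, mem_iInter.2 fun i => Metric.mem_ball_self (hr i)⟩, ?_⟩
  have hHM : ∀ i, H i ∩ U ⊆ M := fun i z hz =>
    (hMU.symm.subset ⟨mem_iUnion.2 ⟨i, hz.1⟩, hz.2⟩).1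
  have hi : ∀ i, ThinEstimate F M E b (H i ∩ Metric.ball x (r i)) := fun i => by
    refine ⟨δ i, hδ i, ε₀ i, hε₀ i, C i, hC i, fun ε h0 h1 v hv =>
      (hest i ε h0 h1 v hv).trans ?_⟩
    have := Metric.thickening_subset_of_subset ε (hHM i)
    gcongr
  refine (ThinEstimate.iUnion hi).mono ?_
  rintro z ⟨hzM, hzU, hzr⟩
  obtain ⟨i, hi⟩ := mem_iUnion.1 (hMU.subset ⟨hzM, hzU⟩).1
  exact mem_iUnion.2 ⟨i, hi, mem_iInter.1 hzr i⟩

theorem IsCompact.thinEstimate {M E : Set E3} (hE : IsCompact E)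
    (h : ∀ x ∈ E, IsOpenBookNear M E x) {b : ℝ} (hb : 0 < b) : ThinEstimate F M E b M := by
  obtain ⟨V, hV, hEV, hest⟩ : ∃ V, IsOpen V ∧ E ⊆ V ∧ ThinEstimate F M E b (M ∩ V) := by
    refine hE.induction_on (p := fun s => ∃ V, IsOpen V ∧ s ⊆ V ∧ ThinEstimate F M E b (M ∩ V))
      ?_ ?_ ?_ ?_
    · exact ⟨∅, isOpen_empty, le_rfl, by simpa using ThinEstimate.empty M E b⟩
    · rintro s t hst ⟨V, hV, htV, hest⟩
      exact ⟨V, hV, hst.trans htV, hest⟩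
    · rintro s t ⟨V, hV, hsV, hest⟩ ⟨V', hV', htV', hest'⟩
      refine ⟨V ∪ V', hV.union hV', union_subset_union hsV htV', ?_⟩
      rw [inter_union_distrib_left]
      exact hest.union hest'
    · intro x hx
      obtain ⟨V, hV, hxV, hest⟩ := (h x hx).exists_thinEstimate (F := F) hb
      exact ⟨V, mem_nhdsWithin_of_mem_nhds (hV.mem_nhds hxV), V, hV, le_rfl, hest⟩
  -- Once `b * ε < ρ`, all of `M` within `b * ε` of `E` lies in the covered set `V`.
  obtain ⟨ρ, hρ, hρV⟩ := hE.exists_thickening_subset_open hV hEV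
  obtain ⟨δ, hδ, ε₀, hε₀, C, hC, hest⟩ := hest
  refine ⟨δ, hδ, min ε₀ (ρ / b), lt_min hε₀ (by positivity), C, hC, fun ε h0 h1 v hv =>
    le_trans (lintegral_mono_set ?_) (hest ε h0 (h1.trans_le (min_le_left _ _)) v hv)⟩
  refine Metric.thickening_subset_of_subset _ fun z hz => ⟨⟨hz.1, hρV ?_⟩, hz.2⟩
  have hbρ : b * ε < ρ := by
    have := h1.trans_le (min_le_right _ _)
    rwa [lt_div_iff₀ hb, mul_comm] at this
  exact Metric.thickening_mono hbρ.le _ hz.2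

/-- The estimate near a compact binding, for `C¹` functions. -/
theorem IsCompact.exists_lintegral_thickening_le {M E : Set E3} (hE : IsCompact E)
    (h : ∀ x ∈ E, IsOpenBookNear M E x) {b : ℝ} (hb : 0 < b) :
    ∃ ε₀ > 0, ∃ C > 0, ∀ ε, 0 < ε → ε < ε₀ → ∀ v : E3 → F, ContDiff ℝ 1 v →
      ∫⁻ z in Metric.thickening ε (M ∩ Metric.thickening (b * ε) E), ‖v z‖ₑ ^ 2 ≤
        ENNReal.ofReal (C * ε) * ((∫⁻ z in Metric.thickening ε M, ‖v z‖ₑ ^ 2) +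
          ∫⁻ z in Metric.thickening ε M, ‖fderiv ℝ v z‖ₑ ^ 2) := by
  obtain ⟨δ, hδ, ε₀, hε₀, C, hC, hest⟩ := hE.thinEstimate (F := F) h hb
  set δ' := min δ 1 with hδ'
  have hδ'0 : 0 < δ' := lt_min hδ one_pos
  set K := 8 * (2 / δ') ^ 3 with hK
  have hK0 : 0 < K := by positivity
  -- The second summand absorbs the gradient term, as `ε ^ 2 ≤ ε₀ * ε`.
  refine ⟨ε₀, hε₀, K * C + K * ε₀, by positivity, fun ε h0 h1 v hv => ?_⟩
  have hs := lintegral_thickening_le_shrink hv (M ∩ Metric.thickening (b * ε) E) h0 hδ'0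
    (min_le_right _ _)
  have ht : ∫⁻ z in Metric.thickening (δ' * ε) (M ∩ Metric.thickening (b * ε) E), ‖v z‖ₑ ^ 2 ≤
      ∫⁻ z in Metric.thickening (δ * ε) (M ∩ Metric.thickening (b * ε) E), ‖v z‖ₑ ^ 2 := by
    refine lintegral_mono_set (Metric.thickening_mono ?_ _)
    gcongr
    exact min_le_left _ _
  have ht := ht.trans (hest ε h0 h1 v hv)
  set Y := (∫⁻ z in Metric.thickening ε M, ‖v z‖ₑ ^ 2) +
    ∫⁻ z in Metric.thickening ε M, ‖fderiv ℝ v z‖ₑ ^ 2 with hY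
  have hD : ∫⁻ z in Metric.thickening ε (M ∩ Metric.thickening (b * ε) E), ‖fderiv ℝ v z‖ₑ ^ 2 ≤
      Y := le_trans (lintegral_mono_set (Metric.thickening_subset_of_subset _ inter_subset_left))
    le_add_self
  refine hs.trans ?_
  calc _ ≤ ENNReal.ofReal K * (ENNReal.ofReal (C * ε) * Y) +
        ENNReal.ofReal (K * ε ^ 2) * Y := by gcongr
    _ = ENNReal.ofReal (K * (C * ε) + K * ε ^ 2) * Y := by
      rw [← mul_assoc, ← ENNReal.ofReal_mul hK0.le, ← add_mul,
        ENNReal.ofReal_add (by positivity) (by positivity)]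
    _ ≤ _ := by
      gcongr
      have : K * ε ^ 2 ≤ K * ε₀ * ε := by
        rw [sq, ← mul_assoc]; gcongr
      linarith

end Compactness

/-! ### From `C¹` functions to Sobolev functions. -/

section Mollification

open scoped Convolution Topology
open ContinuousLinearMap (lsmul)

variable {F : Type*} [NormedAddCommGroup F] [NormedSpace ℝ F]

/-- Convolution with a probability density does not increase the `L²` norm. -/
theorem lintegral_enorm_sq_convolution_le {φ : E3 → ℝ} (hφ : Continuous φ)
    (hφ1 : ∫⁻ t, ‖φ t‖ₑ = 1) {f : E3 → F} (hf : AEStronglyMeasurable f) :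
    ∫⁻ x, ‖(φ ⋆[lsmul ℝ ℝ, volume] f) x‖ₑ ^ 2 ≤ ∫⁻ x, ‖f x‖ₑ ^ 2 := by
  set k := hf.mk f with hk
  have hkm : StronglyMeasurable k := hf.stronglyMeasurable_mk
  have hfk : f =ᵐ[volume] k := hf.ae_eq_mk
  have hfk' : ∫⁻ x, ‖f x‖ₑ ^ 2 = ∫⁻ x, ‖k x‖ₑ ^ 2 :=
    lintegral_congr_ae (hfk.mono fun x hx => by simp only [hx])
  rw [convolution_congr (lsmul ℝ ℝ) (Filter.EventuallyEq.refl _ φ) hfk, hfk']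
  have hm : Measurable fun p : E3 × E3 => ‖φ p.2‖ₑ * ‖k (p.1 - p.2)‖ₑ ^ 2 :=
    (hφ.enorm.measurable.comp measurable_snd).mul
      ((hkm.enorm.comp (measurable_fst.sub measurable_snd)).pow_const 2)
  have hpt : ∀ x, ‖(φ ⋆[lsmul ℝ ℝ, volume] k) x‖ₑ ^ 2 ≤
      ∫⁻ t, ‖φ t‖ₑ * ‖k (x - t)‖ₑ ^ 2 := fun x => by
    have h1 : ‖(φ ⋆[lsmul ℝ ℝ, volume] k) x‖ₑ ≤ ∫⁻ t, ‖φ t‖ₑ * ‖k (x - t)‖ₑ := by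
      refine (enorm_integral_le_lintegral_enorm _).trans (le_of_eq ?_)
      simp [enorm_smul]
    refine (pow_le_pow_left₀ zero_le h1 2).trans ?_
    have h2 := sq_lintegral_mul_le (μ := volume) (f := fun t => ‖φ t‖ₑ)
      (g := fun t => ‖k (x - t)‖ₑ) hφ.enorm.measurable.aemeasurable
      (hkm.enorm.comp (measurable_const.sub measurable_id)).aemeasurable
    rwa [hφ1, one_mul] at h2
  calc _ ≤ ∫⁻ x, ∫⁻ t, ‖φ t‖ₑ * ‖k (x - t)‖ₑ ^ 2 := lintegral_mono hpt
    _ = ∫⁻ t, ∫⁻ x, ‖φ t‖ₑ * ‖k (x - t)‖ₑ ^ 2 := lintegral_lintegral_swap hm.aemeasurable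
    _ = ∫⁻ t, ‖φ t‖ₑ * ∫⁻ x, ‖k x‖ₑ ^ 2 := by
      refine lintegral_congr fun t => ?_
      have hkt : Measurable fun x => ‖k (x - t)‖ₑ ^ 2 :=
        (hkm.enorm.comp (measurable_id.sub_const t)).pow_const 2
      rw [lintegral_const_mul _ hkt, lintegral_sub_right_eq_self (fun x => ‖k x‖ₑ ^ 2) t]
    _ = _ := by rw [lintegral_mul_const _ hφ.enorm.measurable, hφ1, one_mul]

variable {𝕜 : Type*} [RCLike 𝕜]

/-- Cauchy–Schwarz. The `C¹` estimate carries the operator norm of the derivative, the Sobolev norm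
the Euclidean norm of the gradient; only this direction is needed. -/
theorem norm_le_of_apply_single_eq {T : E3 →L[ℝ] 𝕜} {G : EuclideanSpace 𝕜 (Fin 3)}
    (h : ∀ i, T (EuclideanSpace.single i 1) = G i) : ‖T‖ ≤ ‖G‖ := by
  refine T.opNorm_le_bound (norm_nonneg _) fun w => ?_
  have hw : T w = ∑ i, w i • G i := by
    conv_lhs => rw [← (EuclideanSpace.basisFun (Fin 3) ℝ).sum_repr w]
    simp [map_sum, h]
  rw [hw, EuclideanSpace.norm_eq G, EuclideanSpace.norm_eq w, mul_comm]
  refine (norm_sum_le _ _).trans ?_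
  simp only [norm_smul]
  exact Real.sum_mul_le_sqrt_mul_sqrt _ _ _

/-- Inside the domain, the derivative of the mollified function is the mollified weak gradient. -/
theorem fderiv_convolution_apply_single {Ω : Set E3} (hΩ : IsOpen Ω) {u : E3 → 𝕜}
    {g : E3 → EuclideanSpace 𝕜 (Fin 3)} (hu : MemLp u 2 (volume.restrict Ω))
    (hg : HasL2WeakGradient Ω u g) {φ : E3 → ℝ} (hφ : ContDiff ℝ ∞ φ) {η : ℝ}
    (hφs : tsupport φ ⊆ Metric.closedBall 0 η) {x : E3} (hx : Metric.closedBall x η ⊆ Ω)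
    (i : Fin 3) :
    fderiv ℝ (φ ⋆[lsmul ℝ ℝ, volume] Ω.indicator u) x (EuclideanSpace.single i 1) =
      (φ ⋆[lsmul ℝ ℝ, volume] Ω.indicator g) x i := by
  have hΩm := hΩ.measurableSet
  have hφc : HasCompactSupport φ :=
    (isCompact_closedBall (0 : E3) η).of_isClosed_subset (isClosed_tsupport φ) hφs
  have hφ1 : ContDiff ℝ 1 φ := hφ.of_le (by simp)
  have hul : LocallyIntegrable (Ω.indicator u) :=
    ((memLp_indicator_iff_restrict hΩm).2 hu).locallyIntegrable (by norm_num)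
  have hgl : LocallyIntegrable (Ω.indicator g) :=
    ((memLp_indicator_iff_restrict hΩm).2 hg.1).locallyIntegrable (by norm_num)
  set e : E3 := EuclideanSpace.single i 1 with he
  -- This is the test function for the weak gradient; the hypothesis on `x` places its support in
  -- `Ω`.
  set ψ : E3 → ℝ := fun y => φ (x - y) with hψ
  have hψd : ContDiff ℝ ∞ ψ := hφ.comp (contDiff_const.sub contDiff_id)
  have hψs : tsupport ψ ⊆ Metric.closedBall x η := by
    refine closure_minimal (fun y hy => ?_) Metric.isClosed_closedBall
    have := hφs (subset_tsupport φ (show x - y ∈ Function.support φ from hy))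
    rw [mem_closedBall_zero_iff] at this
    rwa [mem_closedBall_iff_norm']
  have hψc : HasCompactSupport ψ :=
    (isCompact_closedBall x η).of_isClosed_subset (isClosed_tsupport ψ) hψs
  have hψf : ∀ y, fderiv ℝ ψ y e = - fderiv ℝ φ (x - y) e := fun y => by
    have h1 : HasFDerivAt (fun y : E3 => x - y) (-ContinuousLinearMap.id ℝ E3) y :=
      (hasFDerivAt_id y).const_sub x
    have h2 := ((hφ1.differentiable one_ne_zero) (x - y)).hasFDerivAt.comp y h1
    rw [show fderiv ℝ ψ y = _ from h2.fderiv]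
    simp
  have hweak := hg.2 ψ hψd hψc (hψs.trans hx) i
  have hL : fderiv ℝ (φ ⋆[lsmul ℝ ℝ, volume] Ω.indicator u) x e =
      ∫ t, (fderiv ℝ φ t e) • Ω.indicator u (x - t) := by
    rw [(hφc.hasFDerivAt_convolution_left (lsmul ℝ ℝ) hφ1 hul x).fderiv]
    have hex := (hφc.fderiv ℝ).convolutionExists_left
      ((lsmul ℝ ℝ : ℝ →L[ℝ] 𝕜 →L[ℝ] 𝕜).precompL E3) (hφ1.continuous_fderiv one_ne_zero) hul x
    rw [convolution, ContinuousLinearMap.integral_apply hex]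
    rfl
  have hR : (φ ⋆[lsmul ℝ ℝ, volume] Ω.indicator g) x i =
      ∫ t, φ t • (Ω.indicator g (x - t)) i := by
    have hex := hφc.convolutionExists_left (lsmul ℝ ℝ : ℝ →L[ℝ]
      EuclideanSpace 𝕜 (Fin 3) →L[ℝ] EuclideanSpace 𝕜 (Fin 3)) hφ1.continuous hgl x
    have := (PiLp.proj (𝕜 := ℝ) 2 (fun _ : Fin 3 => 𝕜) i).integral_comp_comm hex
    exact this.symm
  rw [hL, hR, ← integral_sub_left_eq_self _ volume x,
    ← integral_sub_left_eq_self (fun t => φ t • (Ω.indicator g (x - t)) i) volume x]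
  simp only [sub_sub_cancel]
  rw [← neg_inj, ← integral_neg]
  have e1 : ∀ y, -(fderiv ℝ φ (x - y) e • Ω.indicator u y) =
      Ω.indicator (fun y => fderiv ℝ ψ y e • u y) y := fun y => by
    by_cases hy : y ∈ Ω <;> simp [hy, hψf]
  have e2 : ∀ y, φ (x - y) • (Ω.indicator g y) i = Ω.indicator (fun y => ψ y • g y i) y :=
    fun y => by by_cases hy : y ∈ Ω <;> simp [hy, hψ]
  simp only [e1, e2]
  rw [integral_indicator hΩm, integral_indicator hΩm]
  exact hweak

/-- An `L²` estimate by the `H¹` norm over `ε`-neighbourhoods passes from `C¹` functions to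
functions with a square integrable weak gradient. -/
theorem lintegral_thickening_le_of_hasL2WeakGradient {M E : Set E3} {b C ε₀ : ℝ} (hb : 0 < b)
    (hC : 0 < C)
    (h : ∀ ε, 0 < ε → ε < ε₀ → ∀ v : E3 → 𝕜, ContDiff ℝ 1 v →
      ∫⁻ z in Metric.thickening ε (M ∩ Metric.thickening (2 * b * ε) E), ‖v z‖ₑ ^ 2 ≤
        ENNReal.ofReal (C * ε) * ((∫⁻ z in Metric.thickening ε M, ‖v z‖ₑ ^ 2) +
          ∫⁻ z in Metric.thickening ε M, ‖fderiv ℝ v z‖ₑ ^ 2))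
    {ε : ℝ} (hε : 0 < ε) (hεε₀ : ε < ε₀) {u : E3 → 𝕜} {g : E3 → EuclideanSpace 𝕜 (Fin 3)}
    (hu : MemLp u 2 (volume.restrict (Metric.thickening ε M)))
    (hg : HasL2WeakGradient (Metric.thickening ε M) u g) :
    ∫⁻ z in Metric.thickening ε (M ∩ Metric.thickening (b * ε) E), ‖u z‖ₑ ^ 2 ≤
      ENNReal.ofReal (C * ε) *
        (l2NormSq (Metric.thickening ε M) u + l2NormSq (Metric.thickening ε M) g) := by
  set Ω := Metric.thickening ε M with hΩ
  have hΩo : IsOpen Ω := Metric.isOpen_thickening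
  have hΩm := hΩo.measurableSet
  set A := M ∩ Metric.thickening (b * ε) E with hA
  -- The shift by `2` gives `η n ≤ ε / 2`, so that `b * ε ≤ 2 * b * (ε - η n)`: this is why the
  -- hypothesis has the factor `2`.
  set η : ℕ → ℝ := fun n => ε / (n + 2) with hη
  have hη0 : ∀ n, 0 < η n := fun n => by positivity
  have hη2 : ∀ n, η n ≤ ε / 2 := fun n => by
    simp only [hη]
    gcongr
    linarith [n.cast_nonneg (α := ℝ)]
  have hηlim : Filter.Tendsto η Filter.atTop (𝓝 0) := by
    refine Filter.Tendsto.div_atTop tendsto_const_nhds ?_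
    exact Filter.tendsto_atTop_add_const_right _ _ tendsto_natCast_atTop_atTop
  let ρ : ℕ → ContDiffBump (0 : E3) := fun n =>
    ⟨η n / 2, η n, half_pos (hη0 n), half_lt_self (hη0 n)⟩
  let φ : ℕ → E3 → ℝ := fun n => (ρ n).normed volume
  have hφd : ∀ n, ContDiff ℝ ∞ (φ n) := fun n => (ρ n).contDiff_normed
  have hφs : ∀ n, tsupport (φ n) ⊆ Metric.closedBall 0 (η n) := fun n =>
    ((ρ n).tsupport_normed_eq).subset
  have hφc : ∀ n, HasCompactSupport (φ n) := fun n => (ρ n).hasCompactSupport_normed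
  have hφ1 : ∀ n, ∫⁻ t, ‖φ n t‖ₑ = 1 := fun n => by
    rw [lintegral_congr fun t => Real.enorm_of_nonneg ((ρ n).nonneg_normed t),
      ← ofReal_integral_eq_lintegral_ofReal
        ((hφd n).continuous.integrable_of_hasCompactSupport (hφc n))
        (Filter.Eventually.of_forall fun t => (ρ n).nonneg_normed t), (ρ n).integral_normed,
      ENNReal.ofReal_one]
  have hu2 : MemLp (Ω.indicator u) 2 := (memLp_indicator_iff_restrict hΩm).2 hu
  have hg2 : MemLp (Ω.indicator g) 2 := (memLp_indicator_iff_restrict hΩm).2 hg.1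
  have hul : LocallyIntegrable (Ω.indicator u) := hu2.locallyIntegrable (by norm_num)
  set v : ℕ → E3 → 𝕜 := fun n => φ n ⋆[lsmul ℝ ℝ, volume] Ω.indicator u with hv
  have hvd : ∀ n, ContDiff ℝ 1 (v n) := fun n =>
    (hφc n).contDiff_convolution_left (n := 1) (lsmul ℝ ℝ) ((hφd n).of_le (by simp)) hul
  have hind : ∀ {F' : Type _} [NormedAddCommGroup F'] (f : E3 → F'),
      ∫⁻ x, ‖Ω.indicator f x‖ₑ ^ 2 = l2NormSq Ω f := fun f => by
    rw [l2NormSq, ← lintegral_indicator hΩm]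
    refine lintegral_congr fun x => ?_
    by_cases hx : x ∈ Ω <;> simp [hx]
  set S : ℕ → Set E3 := fun n => Metric.thickening (ε - η n) A with hS
  have hbound : ∀ n, ∫⁻ z in S n, ‖v n z‖ₑ ^ 2 ≤
      ENNReal.ofReal (C * ε) * (l2NormSq Ω u + l2NormSq Ω g) := by
    intro n
    have hpos : 0 < ε - η n := by linarith [hη2 n]
    have hAn : A ⊆ M ∩ Metric.thickening (2 * b * (ε - η n)) E := by
      refine inter_subset_inter_right _ (Metric.thickening_mono ?_ _)
      nlinarith [hη2 n]
    have h1 : ∫⁻ z in Metric.thickening (ε - η n) M, ‖v n z‖ₑ ^ 2 ≤ l2NormSq Ω u := by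
      rw [← hind]
      exact (setLIntegral_le_lintegral _ _).trans
        (lintegral_enorm_sq_convolution_le (hφd n).continuous (hφ1 n) hu2.1)
    have h2 : ∫⁻ z in Metric.thickening (ε - η n) M, ‖fderiv ℝ (v n) z‖ₑ ^ 2 ≤
        l2NormSq Ω g := by
      rw [← hind]
      -- Mollifying at scale `η n` commutes with the weak gradient only at distance from the edge of
      -- `Ω`, hence the thinner neighbourhood.
      refine le_trans ?_ ((setLIntegral_le_lintegral (Metric.thickening (ε - η n) M) _).trans
        (lintegral_enorm_sq_convolution_le (hφd n).continuous (hφ1 n) hg2.1))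
      refine setLIntegral_mono' Metric.isOpen_thickening.measurableSet fun x hx => ?_
      obtain ⟨p, hp, hxp⟩ := Metric.mem_thickening_iff.1 hx
      have hball : Metric.closedBall x (η n) ⊆ Ω := fun y hy => by
        rw [Metric.mem_closedBall] at hy
        refine Metric.mem_thickening_iff.2 ⟨p, hp, ?_⟩
        linarith [dist_triangle y x p]
      refine pow_le_pow_left₀ zero_le ?_ 2
      rw [← ofReal_norm, ← ofReal_norm]
      exact ENNReal.ofReal_le_ofReal (norm_le_of_apply_single_eq fun i =>
        fderiv_convolution_apply_single hΩo hu hg (hφd n) (hφs n) hball i)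
    calc _ ≤ ∫⁻ z in Metric.thickening (ε - η n)
          (M ∩ Metric.thickening (2 * b * (ε - η n)) E), ‖v n z‖ₑ ^ 2 :=
          lintegral_mono_set (Metric.thickening_subset_of_subset _ hAn)
      _ ≤ _ := h _ hpos (by linarith [hη0 n]) (v n) (hvd n)
      _ ≤ _ := by
        gcongr
        linarith [hη0 n]
  have hae : ∀ᵐ x, Filter.Tendsto (fun n => v n x) Filter.atTop (𝓝 (Ω.indicator u x)) :=
    ContDiffBump.ae_convolution_tendsto_right_of_locallyIntegrable (φ := ρ) (K := 2) hηlim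
      (Filter.Eventually.of_forall fun n => (mul_div_cancel₀ (η n) two_ne_zero).ge) hul
  have hAΩ : Metric.thickening ε A ⊆ Ω :=
    Metric.thickening_subset_of_subset _ inter_subset_left
  -- Fatou's lemma: each point of the open neighbourhood of `A` belongs to `S n` for all large `n`.
  calc _ ≤ ∫⁻ z in Metric.thickening ε A, Filter.liminf
          (fun n => (S n).indicator (fun z => ‖v n z‖ₑ ^ 2) z) Filter.atTop := by
        refine lintegral_mono_ae ?_
        filter_upwards [ae_restrict_of_ae hae,
          ae_restrict_mem Metric.isOpen_thickening.measurableSet] with x hx hxA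
        rw [indicator_of_mem (hAΩ hxA)] at hx
        have hev : ∀ᶠ n in Filter.atTop, x ∈ S n := by
          obtain ⟨p, hp, hxp⟩ := Metric.mem_thickening_iff.1 hxA
          filter_upwards [hηlim.eventually (gt_mem_nhds (sub_pos.2 hxp))] with n hn
          exact Metric.mem_thickening_iff.2 ⟨p, hp, by linarith⟩
        have hlim : Filter.Tendsto (fun n => (S n).indicator (fun z => ‖v n z‖ₑ ^ 2) x)
            Filter.atTop (𝓝 (‖u x‖ₑ ^ 2)) := by
          refine Filter.Tendsto.congr' ?_
            (((ENNReal.continuous_pow 2).comp continuous_enorm).continuousAt.tendsto.comp hx)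
          filter_upwards [hev] with n hn
          rw [indicator_of_mem hn]
          rfl
        rw [hlim.liminf_eq]
    _ ≤ ∫⁻ z, Filter.liminf
          (fun n => (S n).indicator (fun z => ‖v n z‖ₑ ^ 2) z) Filter.atTop :=
        setLIntegral_le_lintegral _ _
    _ ≤ Filter.liminf (fun n => ∫⁻ z, (S n).indicator (fun z => ‖v n z‖ₑ ^ 2) z)
          Filter.atTop := by
        refine lintegral_liminf_le fun n => ?_
        exact (((hvd n).continuous.enorm.measurable).pow_const 2).indicator
          Metric.isOpen_thickening.measurableSet
    _ ≤ _ := by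
        refine Filter.liminf_le_of_frequently_le' (Filter.Frequently.of_forall fun n => ?_)
        rw [lintegral_indicator Metric.isOpen_thickening.measurableSet]
        exact hbound n

end Mollification

/-! ### The fattened binding and the final constant. -/

section FattenedBinding

/-- The length of a curve is at least the distance between its endpoints. -/
theorem exists_dist_lt_of_pageDist_lt {P E : Set E3} {x : E3} {d : ℝ}
    (h : pageDist P E x < ENNReal.ofReal d) : ∃ p ∈ E, dist x p < d := by
  simp only [pageDist, iInf_lt_iff] at h
  obtain ⟨γ, ⟨-, h0, h1, -⟩, hγ⟩ := h
  refine ⟨γ 1, h1, ?_⟩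
  have := (eVariationOn.edist_le γ (s := Icc (0 : ℝ) 1) (x := 0) (y := 1) (by simp)
    (by simp)).trans_lt hγ
  rw [h0, edist_dist, ENNReal.ofReal_lt_ofReal_iff_of_nonneg dist_nonneg] at this
  exact this

namespace OpenBook

theorem fattened_eq_thickening (M : OpenBook) (ε : ℝ) :
    M.fattened ε = Metric.thickening ε M.carrier :=
  (Metric.thickening_eq_biUnion_ball).symm

theorem page_subset_carrier (M : OpenBook) (k : Fin M.nM) : M.page k ⊆ M.carrier := by
  rw [M.carrier_eq]
  exact (subset_iUnion M.page k).trans subset_union_left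

theorem binding_subset_carrier (M : OpenBook) (m : Fin M.nE) : M.binding m ⊆ M.carrier := by
  rw [M.carrier_eq]
  exact (subset_iUnion M.binding m).trans subset_union_right

theorem fattenedBinding_subset (M : OpenBook) {a : Fin M.nE → ℝ} (m : Fin M.nE) (ha : 0 < a m)
    {ε : ℝ} (hε : 0 < ε) :
    M.fattenedBinding a m ε ⊆ Metric.thickening ε
      (M.carrier ∩ Metric.thickening (a m * ε) (M.binding m)) := by
  rintro z (hz | hz)
  · simp only [mem_iUnion] at hz
    obtain ⟨x, hx, hzx⟩ := hz
    exact Metric.mem_thickening_iff.2 ⟨x, ⟨M.binding_subset_carrier m hx,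
      Metric.self_subset_thickening (by positivity) _ hx⟩, hzx⟩
  · simp only [mem_iUnion] at hz
    obtain ⟨k, x, ⟨hxk, hx⟩, hzx, -⟩ := hz
    exact Metric.mem_thickening_iff.2 ⟨x, ⟨M.page_subset_carrier k hxk,
      Metric.mem_thickening_iff.2 (exists_dist_lt_of_pageDist_lt hx)⟩, hzx⟩

theorem exists_l2NormSq_fattenedBinding_le (𝕜 : Type*) [RCLike 𝕜] (M : OpenBook)
    (a : Fin M.nE → ℝ) (m : Fin M.nE) (ha : 0 < a m) :
    ∃ c : ℝ, 0 < c ∧ ∀ ε : ℝ, 0 < ε → ∀ u : E3 → 𝕜, MemH1 (M.fattened ε) u →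
      l2NormSq (M.fattenedBinding a m ε) u ≤
        ENNReal.ofReal (c * ε) * h1NormSq (M.fattened ε) u := by
  obtain ⟨ε₀, hε₀, C, hC, hest⟩ :=
    (M.binding_closedCurve m).1.exists_lintegral_thickening_le (F := 𝕜) (M := M.carrier)
      (M.binding_openBook m) (b := 2 * a m) (by positivity)
  -- The summand `1 / ε₀` makes the factor at least `1` when `ε ≥ ε₀`, where enlarging the domain
  -- suffices.
  refine ⟨C + 1 / ε₀, by positivity, fun ε hε u hu => ?_⟩
  have hsub := M.fattenedBinding_subset m ha hε
  have hgrad : HasL2WeakGradient (M.fattened ε) u (weakGradient (M.fattened ε) u) := by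
    rw [weakGradient, dif_pos hu.2]
    exact hu.2.choose_spec
  have hu1 := hu.1
  rw [h1NormSq]
  rw [fattened_eq_thickening] at *
  refine (lintegral_mono_set hsub).trans ?_
  rcases lt_or_ge ε ε₀ with hlt | hge
  · refine (lintegral_thickening_le_of_hasL2WeakGradient ha hC hest hε hlt hu1 hgrad).trans ?_
    gcongr
    have : 0 < 1 / ε₀ := by positivity
    linarith
  · have h1 : 1 ≤ ENNReal.ofReal ((C + 1 / ε₀) * ε) := by
      rw [ENNReal.one_le_ofReal]
      have : 1 ≤ 1 / ε₀ * ε := by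
        rw [one_div, inv_mul_eq_div, one_le_div hε₀]; exact hge
      nlinarith [mul_pos hC hε]
    calc _ ≤ l2NormSq (Metric.thickening ε M.carrier) u :=
          lintegral_mono_set (Metric.thickening_subset_of_subset _ inter_subset_left)
      _ ≤ _ := le_self_add
      _ ≤ _ := le_mul_of_one_le_left zero_le h1

end OpenBook

end FattenedBinding

theorem mainTheorem3 {𝕜 : Type*} [RCLike 𝕜] (M : OpenBook)
    (a : Fin M.nE → ℝ) (ha : ∀ m, 0 < a m) :
    ∃ c : ℝ, 0 < c ∧ ∀ ε : ℝ, 0 < ε → ∀ m : Fin M.nE, ∀ u : E3 → 𝕜,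
      MemH1 (M.fattened ε) u →
        l2NormSq (M.fattenedBinding a m ε) u ≤
          ENNReal.ofReal (c * ε) * h1NormSq (M.fattened ε) u := by
  choose c hc h using fun m => M.exists_l2NormSq_fattenedBinding_le 𝕜 a m (ha m)
  -- The `1` keeps the constant positive even if there are no bindings.
  refine ⟨1 + ∑ m, c m, add_pos_of_pos_of_nonneg one_pos
    (Finset.sum_nonneg fun m _ => (hc m).le), fun ε hε m u hu => (h m ε hε u hu).trans ?_⟩
  gcongr
  have := Finset.single_le_sum (fun m _ => (hc m).le) (Finset.mem_univ m)
  linarith
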